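/- Let $m:[0,\infty)\to[0,\infty)$ be a smooth odd function (i.e. the restriction of a smooth odd function on $\mathbb{R}$) with $m(0)=0$, $m'(0)=1$, and let $(M,h)$ be a Riemannian surface of revolution with vertex $p$ and profile function $m$: a smooth Riemannian surface with global polar coordinates $(r,\theta)$ around $p$, induced by a diffeomorphism of the plane onto $M$ which sends the origin to $p$, in which $$h=dr^2+m(r)^2\,d\theta^2 .$$ Let $\mu>0$ be such that $m(r)<1/\mu$ for all $r\ge 0$, let $W=\mu\,\partial/\partial\theta$ (with $W=0$ at $p$), and let $F=\alpha+\beta$ be the rotational Randers metric with Zermelo navigation data $(h,W)$, that is $$\alpha(y)=\sqrt{\frac{\lambda\,h(y,y)+h(W,y)^2}{\lambda^2}},\qquad \beta(y)=-\frac{h(W,y)}{\lambda},\qquad \lambda=1-h(W,W)=1-\mu^2m^2 .$$ Let $d_h(x,y)$ and $d_F(x,y)$ be the infimum of the $h$-lengths, respectively $F$-lengths, of the $C^1$ curves from $x$ to $y$. Then for every point $q\in M$ $$d_F(p,q)=d_h(p,q)<\infty .$$ Consequently, for every $\rho>0$, the $F$-circle $\{x\in M: d_F(p,x)=\rho\}$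 coincides with the $h$-circle $\{x\in M: d_h(p,x)=\rho\}$, and both are equal to the parallel $\{r=\rho\}$. -/

import Mathlib

open Set MeasureTheory Manifold Bundle
open scoped ENNReal ContDiff Manifold

noncomputable section

/-- The Euclidean plane, on which the charts of a surface are modelled. -/
abbrev Plane : Type := EuclideanSpace ℝ (Fin 2)

namespace Finsler

section Distance

variable {M : Type*} [TopologicalSpace M] [ChartedSpace Plane M]

/-- The length of the curve `γ` over `[a, b]`, measured with a function `F` on the tangent
spaces: the integral of `F (γ t) (γ' t)`. -/
def length (F : ∀ x : M, TangentSpace (𝓡 2) x → ℝ) (γ : ℝ → M) (a b : ℝ) : ℝ≥0∞ :=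
  ∫⁻ t in Icc a b, ENNReal.ofReal (F (γ t) (mfderiv 𝓘(ℝ, ℝ) (𝓡 2) γ t (1 : ℝ)))

/-- The (in general non-symmetric) distance from `x` to `y` induced by `F`: the infimum of the
`F`-lengths of the `C^1` curves from `x` to `y`. For `F = ‖·‖` this is Mathlib's
`Manifold.riemannianEDist`. -/
def edist (F : ∀ x : M, TangentSpace (𝓡 2) x → ℝ) (x y : M) : ℝ≥0∞ :=
  sInf {L : ℝ≥0∞ | ∃ (γ : ℝ → M) (a b : ℝ), a ≤ b ∧ γ a = x ∧ γ b = y ∧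
    ContMDiffOn 𝓘(ℝ, ℝ) (𝓡 2) 1 γ (Icc a b) ∧ L = length F γ a b}

end Distance

section Randers

variable {M : Type*} [TopologicalSpace M] [ChartedSpace Plane M]
  [RiemannianBundle (fun x : M ↦ TangentSpace (𝓡 2) x)]

/-- `λ = 1 - h(W, W)`, for a vector field `W` on a Riemannian surface `(M, h)`. -/
def lam (W : ∀ x : M, TangentSpace (𝓡 2) x) (x : M) : ℝ :=
  1 - inner ℝ (W x) (W x)

/-- `α(y) = √(a_{ij} y^i y^j)`, with `a_{ij} = (λ h_{ij} + W_i W_j) / λ^2`, `W_i = h_{ij} W^j`. -/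
def alpha (W : ∀ x : M, TangentSpace (𝓡 2) x) (x : M) (y : TangentSpace (𝓡 2) x) : ℝ :=
  Real.sqrt ((lam W x * inner ℝ y y + inner ℝ (W x) y ^ 2) / lam W x ^ 2)

/-- `β(y) = b_i y^i`, with `b_i = - W_i / λ`. -/
def beta (W : ∀ x : M, TangentSpace (𝓡 2) x) (x : M) (y : TangentSpace (𝓡 2) x) : ℝ :=
  -(inner ℝ (W x) y) / lam W x

/-- The Randers metric `F = α + β` with Zermelo navigation data `(h, W)`. -/
def randers (W : ∀ x : M, TangentSpace (𝓡 2) x) (x : M) (y : TangentSpace (𝓡 2) x) : ℝ :=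
  alpha W x y + beta W x y

end Randers

end Finsler

/-- The warping functions of surfaces of revolution: a smooth odd function `m`, non-negative on
`[0, ∞)`, with `m(0) = 0` and `m'(0) = 1`. Only the values on `[0, ∞)` matter; a smooth odd function
on `[0, ∞)` is the restriction of a smooth odd function on `ℝ`. -/
structure IsWarpingFunction (m : ℝ → ℝ) : Prop where
  smooth : ContDiff ℝ ∞ m
  odd : ∀ r, m (-r) = -m r
  nonneg : ∀ r, 0 ≤ r → 0 ≤ m r
  map_zero : m 0 = 0
  deriv_zero : deriv m 0 = 1

section Polar

variable {M : Type*} [TopologicalSpace M] [ChartedSpace Plane M]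

/-- The point with polar coordinates `(r, θ)`, for a parametrization `Φ` of `M` by the plane. -/
def polarPoint (Φ : ℂ → M) (r θ : ℝ) : M :=
  Φ (r * Complex.exp (θ * Complex.I))

/-- The coordinate vector `∂/∂r` at the point with polar coordinates `(r, θ)`. -/
def polarDr (Φ : ℂ → M) (r θ : ℝ) : TangentSpace (𝓡 2) (polarPoint Φ r θ) :=
  mfderiv 𝓘(ℝ, ℝ) (𝓡 2) (fun s : ℝ ↦ polarPoint Φ s θ) r (1 : ℝ)

/-- The coordinate vector `∂/∂θ` at the point with polar coordinates `(r, θ)`. -/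
def polarDtheta (Φ : ℂ → M) (r θ : ℝ) : TangentSpace (𝓡 2) (polarPoint Φ r θ) :=
  mfderiv 𝓘(ℝ, ℝ) (𝓡 2) (fun t : ℝ ↦ polarPoint Φ r t) θ (1 : ℝ)

end Polar

/-- A Riemannian surface of revolution `(M, h)` with vertex `p` and warping function `m`: there are
global polar coordinates around `p`, coming from a diffeomorphism of the plane onto `M`, in which
`h = dr² + m(r)² dθ²`. -/
structure SurfaceOfRevolution (M : Type*) [TopologicalSpace M] [ChartedSpace Plane M]
    [RiemannianBundle (fun x : M ↦ TangentSpace (𝓡 2) x)] (p : M) (m : ℝ → ℝ) where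
  isWarping : IsWarpingFunction m
  Φ : Diffeomorph 𝓘(ℝ, ℂ) (𝓡 2) ℂ M ∞
  vertex : Φ 0 = p
  inner_dr_dr : ∀ r θ : ℝ, 0 < r → inner ℝ (polarDr Φ r θ) (polarDr Φ r θ) = 1
  inner_dr_dtheta : ∀ r θ : ℝ, 0 < r → inner ℝ (polarDr Φ r θ) (polarDtheta Φ r θ) = 0
  inner_dtheta_dtheta : ∀ r θ : ℝ, 0 < r →
    inner ℝ (polarDtheta Φ r θ) (polarDtheta Φ r θ) = m r ^ 2

/-- The rotation field `z ↦ μ i z` of the plane, whose flow is `(t, z) ↦ exp(i μ t) z`. -/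
def planeRotationField (μ : ℝ) (z : ℂ) : TangentSpace 𝓘(ℝ, ℂ) z :=
  ((μ : ℂ) * (Complex.I * z) : ℂ)

namespace SurfaceOfRevolution

variable {M : Type*} [TopologicalSpace M] [ChartedSpace Plane M]
    [RiemannianBundle (fun x : M ↦ TangentSpace (𝓡 2) x)] {p : M} {m : ℝ → ℝ}

/-- The wind `W = μ ∂/∂θ`, extended by `0` to the vertex: the vector field on `M` that corresponds
under the parametrization to the rotation field `z ↦ μ i z` of the plane
(see `wind_polarPoint` and `wind_vertex`). -/
def wind (S : SurfaceOfRevolution M p m) (μ : ℝ) (x : M) : TangentSpace (𝓡 2) x :=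
  VectorField.mpullback (𝓡 2) 𝓘(ℝ, ℂ) S.Φ.symm (planeRotationField μ) x

/-- The parallel `{r = ρ}`. -/
def parallel (S : SurfaceOfRevolution M p m) (ρ : ℝ) : Set M :=
  {x | ∃ θ : ℝ, x = polarPoint S.Φ ρ θ}

/-- The rotational Randers metric: the Randers metric with navigation data `(h, μ ∂/∂θ)`. -/
def rotationalRanders (S : SurfaceOfRevolution M p m) (μ : ℝ) (x : M)
    (y : TangentSpace (𝓡 2) x) : ℝ :=
  Finsler.randers (S.wind μ) x y

theorem wind_apply (S : SurfaceOfRevolution M p m) (μ : ℝ) (z : ℂ) :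
    S.wind μ (S.Φ z) = mfderiv 𝓘(ℝ, ℂ) (𝓡 2) S.Φ z (planeRotationField μ z) := by
  have hz : S.Φ.symm (S.Φ z) = z := S.Φ.symm_apply_apply z
  have h1 : MDifferentiableAt 𝓘(ℝ, ℂ) (𝓡 2) S.Φ z := S.Φ.mdifferentiable (by simp) z
  have h2 : MDifferentiableAt (𝓡 2) 𝓘(ℝ, ℂ) S.Φ.symm (S.Φ z) :=
    S.Φ.symm.mdifferentiable (by simp) _
  have h1' : MDifferentiableAt 𝓘(ℝ, ℂ) (𝓡 2) S.Φ (S.Φ.symm (S.Φ z)) := by rwa [hz]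
  have e1 : (mfderiv (𝓡 2) 𝓘(ℝ, ℂ) S.Φ.symm (S.Φ z)).comp (mfderiv 𝓘(ℝ, ℂ) (𝓡 2) S.Φ z) =
      ContinuousLinearMap.id ℝ ℂ := by
    rw [← mfderiv_comp z h2 h1]
    have : (S.Φ.symm ∘ S.Φ : ℂ → ℂ) = id := by ext w; simp
    rw [this]; exact mfderiv_id
  have e2 : (mfderiv 𝓘(ℝ, ℂ) (𝓡 2) S.Φ z).comp (mfderiv (𝓡 2) 𝓘(ℝ, ℂ) S.Φ.symm (S.Φ z)) =
      ContinuousLinearMap.id ℝ Plane := by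
    have h := mfderiv_comp (S.Φ z) h1' h2
    have : (S.Φ ∘ S.Φ.symm : M → M) = id := by ext w; simp
    rw [this, mfderiv_id, hz] at h
    exact h.symm
  have e3 : (mfderiv (𝓡 2) 𝓘(ℝ, ℂ) S.Φ.symm (S.Φ z)).inverse = mfderiv 𝓘(ℝ, ℂ) (𝓡 2) S.Φ z :=
    ContinuousLinearMap.inverse_eq e1 e2
  unfold wind
  rw [VectorField.mpullback_apply, hz]
  exact congrArg (fun f : ℂ →L[ℝ] Plane ↦ f (planeRotationField μ z)) e3

theorem wind_polarPoint (S : SurfaceOfRevolution M p m) (μ r θ : ℝ) :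
    S.wind μ (polarPoint S.Φ r θ) = μ • polarDtheta S.Φ r θ := by
  unfold polarPoint polarDtheta
  rw [wind_apply]
  have hd : HasDerivAt (fun t : ℝ ↦ (r * Complex.exp (t * Complex.I) : ℂ))
      (Complex.I * (r * Complex.exp (θ * Complex.I))) θ := by
    have h : HasDerivAt (fun t : ℝ ↦ ((t : ℂ) * Complex.I)) Complex.I θ := by
      simpa using (Complex.ofRealCLM.hasDerivAt (x := θ)).mul_const Complex.I
    exact (h.cexp.const_mul (r : ℂ)).congr_deriv (by ring)
  have hc := mfderiv_comp θ (S.Φ.mdifferentiable (by simp) ((r : ℂ) * Complex.exp (θ * Complex.I)))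
    hd.differentiableAt.mdifferentiableAt
  have hv : (mfderiv 𝓘(ℝ, ℝ) 𝓘(ℝ, ℂ) (fun t : ℝ ↦ (r * Complex.exp (t * Complex.I) : ℂ)) θ
      (1 : ℝ) : ℂ) = (Complex.I * ((r : ℂ) * Complex.exp (θ * Complex.I)) : ℂ) := by
    rw [mfderiv_eq_fderiv]
    exact hd.deriv
  have hc1 := congrArg (fun f : ℝ →L[ℝ] Plane ↦ f 1) hc
  refine Eq.trans ?_ (congrArg (fun v : Plane ↦ μ • v) hc1.symm)
  have h1 := (mfderiv 𝓘(ℝ, ℂ) (𝓡 2) S.Φ ((r : ℂ) * Complex.exp (θ * Complex.I))).map_smul μ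
    (Complex.I * (r * Complex.exp (θ * Complex.I)) : ℂ)
  have h2 : (planeRotationField μ ((r : ℂ) * Complex.exp (θ * Complex.I)) : ℂ) =
      μ • (Complex.I * (r * Complex.exp (θ * Complex.I)) : ℂ) := Complex.real_smul.symm
  exact ((congrArg (fun w : ℂ ↦ (mfderiv 𝓘(ℝ, ℂ) (𝓡 2) S.Φ
      ((r : ℂ) * Complex.exp (θ * Complex.I)) : ℂ →L[ℝ] Plane) w) h2).trans h1).trans
    (congrArg (fun w : ℂ ↦ μ • (mfderiv 𝓘(ℝ, ℂ) (𝓡 2) S.Φ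
      ((r : ℂ) * Complex.exp (θ * Complex.I)) : ℂ →L[ℝ] Plane) w) hv.symm)

theorem wind_vertex (S : SurfaceOfRevolution M p m) (μ : ℝ) : S.wind μ p = 0 := by
  have h := S.wind_apply μ 0
  rw [S.vertex] at h
  rw [h]
  have h0 : planeRotationField μ 0 = 0 := by
    change ((μ : ℂ) * (Complex.I * 0) : ℂ) = 0
    simp
  rw [h0]
  exact map_zero _

end SurfaceOfRevolution

end

/-! Both distances from the vertex are the radius, for one reason. Let a metric satisfy `F(a ∂r + b
∂θ) ≥ |a|` away from the vertex, and `F(∂r + c ∂θ) ≤ 1` for one constant `c`. By the first bound no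
curve from the vertex is shorter than the radius of its endpoint (`Finsler.ofReal_le_length`); by
the second the spiral `θ' = c r'` attains that radius (`Finsler.edist_polarPoint`). For `h` take `c
= 0`: the spirals are meridians. For the Randers metric take `c = μ`: its unit circles are those of
`h` translated by the wind, so `∂r + W` is a unit vector, and since `W` is tangent to the parallels
no unit vector has radial part above `1` (`abs_le_randers_quotient`). -/

section PolarFrame

variable {M : Type*} [TopologicalSpace M] [ChartedSpace Plane M]

/-- The chain rule for the image of a plane curve under a diffeomorphism of the plane onto `M`. -/
theorem mfderiv_diffeomorph_comp_apply_one (Φ : Diffeomorph 𝓘(ℝ, ℂ) (𝓡 2) ℂ M ∞) {w : ℝ → ℂ}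
    {v : ℂ} {t : ℝ} (hw : HasDerivAt w v t) :
    (mfderiv 𝓘(ℝ, ℝ) (𝓡 2) (fun s ↦ Φ (w s)) t (1 : ℝ) : Plane) =
      (mfderiv 𝓘(ℝ, ℂ) (𝓡 2) Φ (w t) : ℂ →L[ℝ] Plane) v := by
  have hc := mfderiv_comp t (Φ.mdifferentiable (by simp) (w t))
    hw.differentiableAt.mdifferentiableAt
  have hv : (mfderiv 𝓘(ℝ, ℝ) 𝓘(ℝ, ℂ) w t (1 : ℝ) : ℂ) = v := by
    rw [mfderiv_eq_fderiv]
    exact hw.deriv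
  exact (congrArg (fun f : ℝ →L[ℝ] Plane ↦ f 1) hc).trans
    (congrArg (fun u : ℂ ↦ (mfderiv 𝓘(ℝ, ℂ) (𝓡 2) Φ (w t) : ℂ →L[ℝ] Plane) u) hv)

theorem polarDr_eq_mfderiv (Φ : Diffeomorph 𝓘(ℝ, ℂ) (𝓡 2) ℂ M ∞) (r θ : ℝ) :
    (polarDr Φ r θ : Plane) =
      (mfderiv 𝓘(ℝ, ℂ) (𝓡 2) Φ (r * Complex.exp (θ * Complex.I)) : ℂ →L[ℝ] Plane)
        (Complex.exp (θ * Complex.I)) := by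
  refine mfderiv_diffeomorph_comp_apply_one Φ (w := fun s : ℝ ↦ (s : ℂ) * Complex.exp (θ * Complex.I)) ?_
  simpa using (Complex.ofRealCLM.hasDerivAt (x := r)).mul_const (Complex.exp (θ * Complex.I))

theorem hasDerivAt_exp_ofReal_mul_I (θ : ℝ) :
    HasDerivAt (fun t : ℝ ↦ Complex.exp (t * Complex.I))
      (Complex.I * Complex.exp (θ * Complex.I)) θ := by
  have h : HasDerivAt (fun t : ℝ ↦ ((t : ℂ) * Complex.I)) Complex.I θ := by
    simpa using (Complex.ofRealCLM.hasDerivAt (x := θ)).mul_const Complex.I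
  exact h.cexp.congr_deriv (by ring)

theorem polarDtheta_eq_mfderiv (Φ : Diffeomorph 𝓘(ℝ, ℂ) (𝓡 2) ℂ M ∞) (r θ : ℝ) :
    (polarDtheta Φ r θ : Plane) =
      (mfderiv 𝓘(ℝ, ℂ) (𝓡 2) Φ (r * Complex.exp (θ * Complex.I)) : ℂ →L[ℝ] Plane)
        ((r : ℂ) * (Complex.I * Complex.exp (θ * Complex.I))) :=
  mfderiv_diffeomorph_comp_apply_one Φ (w := fun s : ℝ ↦ (r : ℂ) * Complex.exp (s * Complex.I))
    ((hasDerivAt_exp_ofReal_mul_I θ).const_mul (r : ℂ))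

/-- The velocity of a curve, in terms of the polar frame. -/
theorem mfderiv_eq_polar_frame (Φ : Diffeomorph 𝓘(ℝ, ℂ) (𝓡 2) ℂ M ∞) {w : ℝ → ℂ} {t r θ a b : ℝ}
    (hw : HasDerivAt w (a * Complex.exp (θ * Complex.I) +
      b * (r * (Complex.I * Complex.exp (θ * Complex.I)))) t)
    (hwt : w t = r * Complex.exp (θ * Complex.I)) :
    (mfderiv 𝓘(ℝ, ℝ) (𝓡 2) (fun s ↦ Φ (w s)) t (1 : ℝ) : Plane) =
      a • (polarDr Φ r θ : Plane) + b • (polarDtheta Φ r θ : Plane) := by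
  rw [mfderiv_diffeomorph_comp_apply_one Φ hw, polarDr_eq_mfderiv, polarDtheta_eq_mfderiv, hwt,
    ← Complex.real_smul (x := a), ← Complex.real_smul (x := b)]
  have hlin : ∀ (L : ℂ →L[ℝ] Plane) (x y : ℂ), L (a • x + b • y) = a • L x + b • L y :=
    fun L x y ↦ by rw [map_add, map_smul, map_smul]
  exact hlin _ _ _

end PolarFrame

/-! ### Distance from the vertex for a general speed function -/

namespace Finsler

variable {M : Type*} [TopologicalSpace M] [ChartedSpace Plane M]

/-- If the speed `F` dominates the radial speed, then the distance from the vertex is at least the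
radius. -/
theorem ofReal_le_length (Φ : Diffeomorph 𝓘(ℝ, ℂ) (𝓡 2) ℂ M ∞)
    (F : ∀ x : M, TangentSpace (𝓡 2) x → ℝ)
    (hF : ∀ r θ a b : ℝ, 0 < r →
      |a| ≤ F (polarPoint Φ r θ) (a • polarDr Φ r θ + b • polarDtheta Φ r θ))
    {γ : ℝ → M} {a b : ℝ} (hab : a ≤ b) (ha : γ a = Φ 0)
    (hγ : ContMDiffOn 𝓘(ℝ, ℝ) (𝓡 2) 1 γ (Icc a b)) :
    ENNReal.ofReal ‖Φ.symm (γ b)‖ ≤ length F γ a b := by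
  set w : ℝ → ℂ := fun t ↦ Φ.symm (γ t) with hw
  have hΦw : (fun t ↦ Φ (w t)) = γ := by ext t; simp [hw]
  have hwa : w a = 0 := by simp [hw, ha]
  have hwC : ContDiffOn ℝ 1 w (Icc a b) := by
    rw [← contMDiffOn_iff_contDiffOn]
    exact (Φ.symm.contMDiff.of_le (by simp)).comp_contMDiffOn hγ
  suffices key : ∀ ε : ℝ, 0 < ε → ENNReal.ofReal (‖w b‖ - ε) ≤ length F γ a b by
    refine ENNReal.le_of_forall_pos_le_add fun ε hε _ ↦ ?_
    calc ENNReal.ofReal ‖w b‖ = ENNReal.ofReal ((‖w b‖ - ε) + ε) := by simp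
      _ ≤ ENNReal.ofReal (‖w b‖ - ε) + ENNReal.ofReal ε := ENNReal.ofReal_add_le
      _ ≤ length F γ a b + ε := by
        simpa using key ε (by exact_mod_cast hε)
  intro ε hε
  -- The radius `‖w‖` may fail to be differentiable when the curve meets the vertex. This smoothing
  -- starts at `ε`, so it costs at most `ε`, and it never grows faster than the radius.
  set f : ℝ → ℝ := fun t ↦ Real.sqrt (‖w t‖ ^ 2 + ε ^ 2) with hf
  have hfC : ContDiffOn ℝ 1 f (Icc a b) :=
    ((hwC.norm_sq ℝ).add contDiffOn_const).sqrt fun t _ ↦ by positivity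
  have hfb : ‖w b‖ - ε ≤ |f b - f a| := by
    have h1 : f a = ε := by simp [hf, hwa, Real.sqrt_sq hε.le]
    have h2 : ‖w b‖ ≤ f b := Real.le_sqrt_of_sq_le (by nlinarith)
    rw [h1]
    exact (by linarith : ‖w b‖ - ε ≤ f b - ε).trans (le_abs_self _)
  refine (ENNReal.ofReal_le_ofReal hfb).trans ?_
  rw [← Real.norm_eq_abs, ofReal_norm]
  refine (enorm_sub_le_lintegral_deriv_of_contDiffOn_Icc hfC hab).trans ?_
  unfold length
  -- At the endpoints the derivative of `γ` also depends on its values outside the interval, which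
  -- are not controlled.
  rw [← restrict_Ioo_eq_restrict_Icc]
  refine setLIntegral_mono' measurableSet_Ioo fun t ht ↦ ?_
  have hwt : HasDerivAt w (deriv w t) t :=
    ((hwC.differentiableOn (by simp)).differentiableAt (Icc_mem_nhds ht.1 ht.2)).hasDerivAt
  have hft : HasDerivAt f (inner ℝ (w t) (deriv w t) / Real.sqrt (‖w t‖ ^ 2 + ε ^ 2)) t := by
    refine ((hwt.norm_sq.add_const (ε ^ 2)).sqrt (by positivity)).congr_deriv ?_
    rw [mul_div_mul_left _ _ two_ne_zero]
  rw [hft.deriv]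
  rcases eq_or_ne (w t) 0 with h0 | h0
  -- At the vertex there is no polar frame, but there the derivative of `f` vanishes.
  · simp [h0]
  rw [← ofReal_norm]
  refine ENNReal.ofReal_le_ofReal ?_
  set r := ‖w t‖ with hr
  set θ := Complex.arg (w t)
  have hr0 : 0 < r := norm_pos_iff.2 h0
  have hpolar : w t = r * Complex.exp (θ * Complex.I) := (Complex.norm_mul_exp_arg_mul_I _).symm
  -- Rotating the velocity back by `θ` makes its real part the radial speed and its imaginary part
  -- `r` times the angular speed.
  set u := deriv w t * Complex.exp (-(θ * Complex.I)) with hu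
  have hv : deriv w t = u * Complex.exp (θ * Complex.I) := by
    rw [hu, mul_assoc, ← Complex.exp_add]; simp
  have hinner : inner ℝ (w t) (deriv w t) = r * u.re := by
    have hc : (starRingEnd ℂ) (Complex.exp (θ * Complex.I)) = Complex.exp (-(θ * Complex.I)) := by
      rw [← Complex.exp_conj]; simp
    rw [Complex.inner, hpolar, map_mul, hc, Complex.conj_ofReal]
    rw [show deriv w t * (r * Complex.exp (-(θ * Complex.I))) = r * u by rw [hu]; ring]
    simp
  have hvel := mfderiv_eq_polar_frame Φ (w := w) (t := t) (r := r) (θ := θ) (a := u.re)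
    (b := u.im / r) (hwt.congr_deriv (by
      rw [hv]
      conv_lhs => rw [← Complex.re_add_im u]
      have : (r : ℂ) ≠ 0 := by exact_mod_cast hr0.ne'
      push_cast
      field_simp)) hpolar
  rw [hΦw] at hvel
  have hpt : γ t = polarPoint Φ r θ := by
    rw [polarPoint, ← hpolar]; simp [hw]
  have hFt : F (γ t) (mfderiv 𝓘(ℝ, ℝ) (𝓡 2) γ t (1 : ℝ)) = F (polarPoint Φ r θ)
      (u.re • polarDr Φ r θ + (u.im / r) • polarDtheta Φ r θ) := by
    -- The two vectors lie in tangent spaces at different expressions for the same point; viewing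
    -- both in `Plane` allows substitution.
    have hgen : ∀ (x y : M) (v v' : Plane), x = y → v = v' → F x v = F y v' := by
      rintro x _ v _ rfl rfl; rfl
    exact hgen _ _ _ _ hpt hvel
  rw [hFt]
  refine le_trans ?_ (hF r θ u.re (u.im / r) hr0)
  have hs : 0 < Real.sqrt (r ^ 2 + ε ^ 2) := by positivity
  rw [hinner, Real.norm_eq_abs, abs_div, abs_mul, abs_of_pos hr0, abs_of_pos hs, div_le_iff₀ hs,
    mul_comm]
  exact mul_le_mul_of_nonneg_left (Real.le_sqrt_of_sq_le (by nlinarith)) (abs_nonneg _)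

/-- If in addition `F` is at most `1` on the velocities of the spirals `θ' = c r'`, then the
distance from the vertex is the radius. -/
theorem edist_polarPoint (Φ : Diffeomorph 𝓘(ℝ, ℂ) (𝓡 2) ℂ M ∞)
    (F : ∀ x : M, TangentSpace (𝓡 2) x → ℝ) (c : ℝ)
    (hF : ∀ r θ a b : ℝ, 0 < r →
      |a| ≤ F (polarPoint Φ r θ) (a • polarDr Φ r θ + b • polarDtheta Φ r θ))
    (hF' : ∀ r θ : ℝ, 0 < r →
      F (polarPoint Φ r θ) ((1 : ℝ) • polarDr Φ r θ + c • polarDtheta Φ r θ) ≤ 1)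
    {p : M} (hp : Φ 0 = p) (r θ : ℝ) (hr : 0 ≤ r) :
    edist F p (polarPoint Φ r θ) = ENNReal.ofReal r := by
  apply le_antisymm
  -- The shift by `r` makes the spiral arrive at angle `θ`; written in the plane, it is smooth at
  -- the vertex too.
  · set w : ℝ → ℂ := fun t ↦ t * Complex.exp ((c * (t - r) + θ : ℝ) * Complex.I) with hw
    have hwC : ContDiff ℝ 1 w := by
      have h1 : ContDiff ℝ 1 (fun t : ℝ ↦ (t : ℂ)) := Complex.ofRealCLM.contDiff
      have h2 : ContDiff ℝ 1 (fun t : ℝ ↦ ((c * (t - r) + θ : ℝ) : ℂ)) :=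
        
        Complex.ofRealCLM.contDiff.comp
          ((contDiff_const.mul (contDiff_id.sub contDiff_const)).add contDiff_const)
      exact h1.mul (h2.mul contDiff_const).cexp
    refine (sInf_le (mem_ofPred_eq.mpr ⟨fun t ↦ Φ (w t), 0, r, hr, by simp [hw, hp],
      by simp [hw, polarPoint],
      ((Φ.contMDiff.of_le (by simp)).comp hwC.contMDiff).contMDiffOn, rfl⟩)).trans ?_
    · unfold length
      calc _ ≤ ∫⁻ _ in Icc 0 r, (1 : ℝ≥0∞) := by
            rw [← restrict_Ioo_eq_restrict_Icc]
            refine setLIntegral_mono' measurableSet_Ioo fun t ht ↦ ?_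
            rw [ENNReal.ofReal_le_one]
            have hd : HasDerivAt w (((1 : ℝ) : ℂ) * Complex.exp ((c * (t - r) + θ : ℝ) * Complex.I) +
                c * (t * (Complex.I * Complex.exp ((c * (t - r) + θ : ℝ) * Complex.I)))) t := by
              have h1 : HasDerivAt (fun s : ℝ ↦ c * (s - r) + θ) c t := by
                simpa using (((hasDerivAt_id t).sub_const r).const_mul c).add_const θ
              have h2 := (hasDerivAt_exp_ofReal_mul_I (c * (t - r) + θ)).scomp t h1
              refine ((Complex.ofRealCLM.hasDerivAt (x := t)).mul h2).congr_deriv ?_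
              simp
              ring
            have hvel := mfderiv_eq_polar_frame Φ (θ := c * (t - r) + θ) hd rfl
            have := hF' t (c * (t - r) + θ) ht.1
            exact (congrArg (fun v : Plane ↦ F (Φ (w t)) v) hvel).trans_le this
        _ = ENNReal.ofReal r := by simp
  · refine le_sInf ?_
    rintro L ⟨γ, a, b, hab, ha, hb, hγ, rfl⟩
    have h := ofReal_le_length Φ F hF hab (ha.trans hp.symm) hγ
    rw [hb] at h
    simpa [polarPoint, abs_of_nonneg hr, Complex.norm_exp_ofReal_mul_I] using h

end Finsler

/-! ### The Riemannian and Randers metrics in the polar frame -/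

section Metric

variable {M : Type*} [TopologicalSpace M] [ChartedSpace Plane M]
    [RiemannianBundle (fun x : M ↦ TangentSpace (𝓡 2) x)]

/-- The distance induced by the norms of the tangent spaces is the Riemannian distance. -/
theorem Finsler.edist_norm_eq_riemannianEDist [IsManifold (𝓡 2) 1 M] (x y : M) :
    Finsler.edist (fun (x : M) (v : TangentSpace (𝓡 2) x) ↦ ‖v‖) x y =
      riemannianEDist (𝓡 2) x y := by
  have hlen : ∀ (γ : ℝ → M) (a b : ℝ),
      Finsler.length (fun (x : M) (v : TangentSpace (𝓡 2) x) ↦ ‖v‖) γ a b =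
        pathELength (𝓡 2) γ a b := fun γ a b ↦ by
    rw [pathELength_eq_lintegral_mfderiv_Icc]
    simp only [Finsler.length, ofReal_norm]
    rfl
  apply le_antisymm
  · refine le_of_forall_gt fun L hL ↦ ?_
    obtain ⟨γ, h0, h1, hγ, hlt⟩ := exists_lt_of_riemannianEDist_lt hL
    refine (sInf_le (mem_ofPred_eq.mpr ⟨γ, 0, 1, zero_le_one, h0, h1, hγ, rfl⟩)).trans_lt ?_
    rwa [hlen]
  · refine le_sInf ?_
    rintro L ⟨γ, a, b, hab, ha, hb, hγ, rfl⟩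
    rw [hlen]
    exact riemannianEDist_le_pathELength hγ ha hb hab

namespace SurfaceOfRevolution

variable {p : M} {m : ℝ → ℝ}

theorem inner_polar_frame (S : SurfaceOfRevolution M p m) {r : ℝ} (θ a b a' b' : ℝ) (hr : 0 < r) :
    inner ℝ (a • polarDr S.Φ r θ + b • polarDtheta S.Φ r θ)
      (a' • polarDr S.Φ r θ + b' • polarDtheta S.Φ r θ) = a * a' + m r ^ 2 * (b * b') := by
  have h := S.inner_dr_dtheta r θ hr
  have h' := h
  rw [real_inner_comm] at h'
  simp only [inner_add_left, inner_add_right, real_inner_smul_left, real_inner_smul_right,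
    S.inner_dr_dr r θ hr, S.inner_dtheta_dtheta r θ hr, h, h']
  ring

theorem abs_le_norm_polar_frame (S : SurfaceOfRevolution M p m) (r θ a b : ℝ) (hr : 0 < r) :
    |a| ≤ ‖a • polarDr S.Φ r θ + b • polarDtheta S.Φ r θ‖ := by
  rw [norm_eq_sqrt_real_inner, S.inner_polar_frame θ a b a b hr]
  exact Real.abs_le_sqrt (by nlinarith [mul_nonneg (sq_nonneg (m r)) (mul_self_nonneg b)])

theorem norm_polarDr (S : SurfaceOfRevolution M p m) {r : ℝ} (θ : ℝ) (hr : 0 < r) :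
    ‖polarDr S.Φ r θ‖ = 1 := by
  rw [norm_eq_sqrt_real_inner, S.inner_dr_dr r θ hr, Real.sqrt_one]

/-- The rotational Randers metric in the polar frame. -/
theorem rotationalRanders_polar_frame (S : SurfaceOfRevolution M p m) (μ : ℝ) {r : ℝ}
    (θ a b : ℝ) (hr : 0 < r) (hμ : 0 < 1 - μ ^ 2 * m r ^ 2) :
    S.rotationalRanders μ (polarPoint S.Φ r θ) (a • polarDr S.Φ r θ + b • polarDtheta S.Φ r θ) =
      (Real.sqrt ((1 - μ ^ 2 * m r ^ 2) * a ^ 2 + m r ^ 2 * b ^ 2) - μ * m r ^ 2 * b) /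
        (1 - μ ^ 2 * m r ^ 2) := by
  have hW : S.wind μ (polarPoint S.Φ r θ) =
      (0 : ℝ) • polarDr S.Φ r θ + μ • polarDtheta S.Φ r θ := by
    rw [S.wind_polarPoint, zero_smul, zero_add]
  have hl : Finsler.lam (S.wind μ) (polarPoint S.Φ r θ) = 1 - μ ^ 2 * m r ^ 2 := by
    rw [Finsler.lam, hW, S.inner_polar_frame _ _ _ _ _ hr]; ring
  simp only [rotationalRanders, Finsler.randers, Finsler.alpha, Finsler.beta, hl]
  rw [hW, S.inner_polar_frame _ _ _ _ _ hr, S.inner_polar_frame _ _ _ _ _ hr,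
    Real.sqrt_div' _ (sq_nonneg _), Real.sqrt_sq hμ.le, ← add_div]
  congr 1
  rw [sub_eq_add_neg]
  congr 2 <;> ring

end SurfaceOfRevolution

end Metric

/-- With `λ = 1 - μ² n²`, the radicand minus `(λ |a| + μ n² b)²` is `λ n² (μ |a| - b)²`. It vanishes
at `b = μ |a|`, the direction of the spirals when `a > 0`. -/
theorem abs_le_randers_quotient {μ n a b : ℝ} (h : 0 < 1 - μ ^ 2 * n ^ 2) :
    |a| ≤ (Real.sqrt ((1 - μ ^ 2 * n ^ 2) * a ^ 2 + n ^ 2 * b ^ 2) - μ * n ^ 2 * b) /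
      (1 - μ ^ 2 * n ^ 2) := by
  rw [le_div_iff₀ h, le_sub_iff_add_le]
  apply Real.le_sqrt_of_sq_le
  rw [← sq_abs a]
  nlinarith [mul_nonneg h.le (mul_nonneg (sq_nonneg n) (sq_nonneg (μ * |a| - b)))]

theorem mainTheorem7 {M : Type*} [TopologicalSpace M] [ChartedSpace Plane M]
    [IsManifold (𝓡 2) ∞ M]
    [RiemannianBundle (fun x : M ↦ TangentSpace (𝓡 2) x)]
    [IsContMDiffRiemannianBundle (𝓡 2) ∞ Plane (fun x : M ↦ TangentSpace (𝓡 2) x)]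
    (p : M) (m : ℝ → ℝ) (S : SurfaceOfRevolution M p m)
    (μ : ℝ) (hμ : 0 < μ) (hm : ∀ r : ℝ, 0 ≤ r → m r < 1 / μ) :
    (∀ q : M, Finsler.edist (S.rotationalRanders μ) p q = riemannianEDist (𝓡 2) p q ∧
      riemannianEDist (𝓡 2) p q ≠ ⊤) ∧
    (∀ ρ : ℝ, 0 < ρ →
      {x : M | Finsler.edist (S.rotationalRanders μ) p x = ENNReal.ofReal ρ} =
        {x : M | riemannianEDist (𝓡 2) p x = ENNReal.ofReal ρ} ∧
      {x : M | Finsler.edist (S.rotationalRanders μ) p x = ENNReal.ofReal ρ} = S.parallel ρ) := by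
  have hlam : ∀ r : ℝ, 0 < r → 0 < 1 - μ ^ 2 * m r ^ 2 := fun r hr ↦ by
    have h1 : μ * m r < 1 := by
      have := hm r hr.le
      rwa [lt_div_iff₀ hμ, mul_comm] at this
    have h2 : 0 ≤ μ * m r := mul_nonneg hμ.le (S.isWarping.nonneg r hr.le)
    nlinarith
  have hdF : ∀ r θ : ℝ, 0 ≤ r →
      Finsler.edist (S.rotationalRanders μ) p (polarPoint S.Φ r θ) = ENNReal.ofReal r := by
    intro r θ hr
    refine Finsler.edist_polarPoint S.Φ _ μ (fun r θ a b hr ↦ ?_) (fun r θ hr ↦ ?_) S.vertex r θ hr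
    · rw [S.rotationalRanders_polar_frame μ θ a b hr (hlam r hr)]
      exact abs_le_randers_quotient (hlam r hr)
    -- Along `∂r + μ ∂θ` the radicand is `λ + μ² m² = 1`, and the numerator becomes `λ` itself.
    · rw [S.rotationalRanders_polar_frame μ θ 1 μ hr (hlam r hr), div_le_one (hlam r hr),
        show (1 - μ ^ 2 * m r ^ 2) * 1 ^ 2 + m r ^ 2 * μ ^ 2 = 1 by ring, Real.sqrt_one]
      exact le_of_eq (by ring)
  have hdh : ∀ r θ : ℝ, 0 ≤ r →
      riemannianEDist (𝓡 2) p (polarPoint S.Φ r θ) = ENNReal.ofReal r := by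
    intro r θ hr
    have : IsManifold (𝓡 2) 1 M := IsManifold.of_le (n := ∞) (by simp)
    rw [← Finsler.edist_norm_eq_riemannianEDist]
    refine Finsler.edist_polarPoint S.Φ _ 0 (fun r θ a b hr ↦ ?_) (fun r θ hr ↦ ?_) S.vertex r θ hr
    · exact S.abs_le_norm_polar_frame r θ a b hr
    · rw [one_smul, zero_smul, add_zero, S.norm_polarDr θ hr]
  have hpolar : ∀ x : M, ∃ r θ : ℝ, 0 ≤ r ∧ x = polarPoint S.Φ r θ := fun x ↦
    ⟨‖S.Φ.symm x‖, Complex.arg (S.Φ.symm x), norm_nonneg _, by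
      rw [polarPoint, Complex.norm_mul_exp_arg_mul_I, S.Φ.apply_symm_apply]⟩
  have heq : ∀ q : M,
      Finsler.edist (S.rotationalRanders μ) p q = riemannianEDist (𝓡 2) p q := fun q ↦ by
    obtain ⟨r, θ, hr, rfl⟩ := hpolar q
    rw [hdF r θ hr, hdh r θ hr]
  refine ⟨fun q ↦ ⟨heq q, ?_⟩, fun ρ hρ ↦ ⟨by simp only [heq], ?_⟩⟩
  · obtain ⟨r, θ, hr, rfl⟩ := hpolar q
    rw [hdh r θ hr]
    exact ENNReal.ofReal_ne_top
  · ext x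
    constructor
    · intro hx
      obtain ⟨r, θ, hr, rfl⟩ := hpolar x
      rw [mem_ofPred_eq, hdF r θ hr, ENNReal.ofReal_eq_ofReal_iff hr hρ.le] at hx
      exact ⟨θ, by rw [hx]⟩
    · rintro ⟨θ, rfl⟩
      exact hdF ρ θ hρ.le
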